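/- Consider structures with underlying set $\mathbb{N}$ for signatures with finitely many relation and operation symbols. Identify such a structure with the characteristic function of the set of tuples consisting of its relations and the graphs of its operations, that is, with a point of $2^X$, where $X$ is the disjoint union of one copy of $\mathbb{N}^k$ for each $k$-ary relation symbol and one copy of $\mathbb{N}^{k+1}$ for each $k$-ary operation symbol. Every class of such structures carries the subspace topology of the product topology on $2^X$. A class is first-order if it consists of all models with underlying set $\mathbb{N}$ of some set of first-order sentences in the signature. Let $E$ and $F$ be equivalence relations on $Y$ and $Z$. Then $E$ is Borel reducible to $F$ if there is a Borel map $f\colon Y\to Z$ such that $x\mathrel{E}x'\iff f(x)\mathrel{F}f(x')$ for all $x,x'\in Y$. A first-order class is Borel complete if the isomorphism relation of every first-order class (for any finite signature) is Borel reducible to its isomorphism relation. For a binary operation $*$ on a set $A$ consider the axioms 1. $a*(b*c)=(a*b)*(a*c)$ for all $a,b,c\in A$; 2. for all $a,c\in A$ there is a unique $b\in A$ with $a*b=c$; 3. $a*a=a$ for all $a\in A$; 4. $a*(a*b)=b$ for all $a,b\in A$. A left distributive algebra is a set with a binary operation satisfying 1; a rack satisfies 1 and 2; a quandle satisfies 1,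 2 and 3; a kei satisfies 1, 2, 3 and 4. An algebra satisfying $\Sigma$ is a set $A$ with two binary operations $*$ and $\circ$ such that, for all $a,b,c\in A$, $$a\circ(b\circ c)=(a\circ b)\circ c,\qquad (a\circ b)*c=a*(b*c),\qquad a*(b\circ c)=(a*b)\circ(a*c),\qquad (a*b)\circ a=a\circ b.$$ **Theorem.** The classes of keis, quandles, racks, left distributive algebras, and algebras satisfying $\Sigma$, each with underlying set $\mathbb{N}$, are each first-order and Borel complete. -/

import Mathlib

namespace CountableModels

noncomputable section

/-! ### The space of structures with underlying set `ℕ` -/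

/-- The set of all potential tuples of an `L`-structure on `ℕ`: for every operation symbol of arity
`n` a copy of `ℕⁿ × ℕ` (its graph), and for every relation symbol of arity `n` a copy of `ℕⁿ`. -/
abbrev TupleIndex (L : FirstOrder.Language.{0, 0}) : Type :=
  (Σ f : (Σ n, L.Functions n), (Fin f.1 → ℕ) × ℕ) ⊕ (Σ r : (Σ n, L.Relations n), (Fin r.1 → ℕ))

open Classical in
/-- An `L`-structure on `ℕ`, identified with a point of the Cantor space `2^X`, where `X` is the set
of tuples: the characteristic function of the graphs of its operations and of its relations. -/
def code {L : FirstOrder.Language.{0, 0}} (S : L.Structure ℕ) : TupleIndex L → Bool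
  | Sum.inl ⟨⟨_, f⟩, (x, y)⟩ => decide (S.funMap f x = y)
  | Sum.inr ⟨⟨_, r⟩, x⟩ => decide (S.RelMap r x)

/-- The space of `L`-structures on `ℕ` carries the subspace topology of the Cantor space (the product
of copies of the discrete two-point space). -/
instance structureTopology (L : FirstOrder.Language.{0, 0}) : TopologicalSpace (L.Structure ℕ) :=
  TopologicalSpace.induced code inferInstance

/-- Distinct structures have distinct codes, so the space of structures is a subspace of the Cantor
space. -/
theorem code_injective (L : FirstOrder.Language.{0, 0}) :
    Function.Injective (code : L.Structure ℕ → TupleIndex L → Bool) := by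
  intro S S' h
  ext n g x
  · have := congrFun h (Sum.inl ⟨⟨n, g⟩, (x, S'.funMap g x)⟩)
    simpa [code] using this
  · have := congrFun h (Sum.inr ⟨⟨n, g⟩, x⟩)
    simpa [code] using this

/-- Isomorphism of the members of a class `K` of `L`-structures on `ℕ`. -/
def isoOn {L : FirstOrder.Language.{0, 0}} (K : Set (L.Structure ℕ)) : Setoid K where
  r S S' := Nonempty (@FirstOrder.Language.Equiv L ℕ ℕ S.1 S'.1)
  iseqv :=
    { refl := fun S => ⟨@FirstOrder.Language.Equiv.refl L ℕ S.1⟩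
      symm := fun {S S'} ⟨e⟩ => ⟨@FirstOrder.Language.Equiv.symm L ℕ ℕ S.1 S'.1 e⟩
      trans := fun {S S' S''} ⟨e⟩ ⟨e'⟩ =>
        ⟨@FirstOrder.Language.Equiv.comp L ℕ ℕ S.1 S'.1 ℕ S''.1 e' e⟩ }

/-- `K` is a first-order class of structures on `ℕ`: the signature has finitely many symbols, and
`K` consists of all the models with underlying set `ℕ` of some set of first-order sentences. -/
def IsFirstOrderClass {L : FirstOrder.Language.{0, 0}} (K : Set (L.Structure ℕ)) : Prop :=
  Finite L.Symbols ∧ ∃ T : L.Theory, K = {S | @FirstOrder.Language.Theory.Model L ℕ S T}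

/-! ### Borel reducibility and Borel completeness -/

/-- `E` is Borel reducible to `F`: for some Borel map `f`, `E x x'` holds if and only if
`F (f x) (f x')` does. -/
def BorelReducible {X Y : Type} [TopologicalSpace X] [TopologicalSpace Y]
    (E : Setoid X) (F : Setoid Y) : Prop :=
  ∃ f : X → Y, @Measurable X Y (borel X) (borel Y) f ∧ ∀ x x' : X, E x x' ↔ F (f x) (f x')

/-- A first-order class `K` of structures on `ℕ` is Borel complete if the isomorphism relation of
every first-order class of structures on `ℕ` is Borel reducible to the isomorphism relation of `K`.
Each class carries the subspace topology. (A finite signature may be taken to live in `Type`.) -/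
def IsBorelComplete {L : FirstOrder.Language.{0, 0}} (K : Set (L.Structure ℕ)) : Prop :=
  IsFirstOrderClass K ∧
    ∀ (L' : FirstOrder.Language.{0, 0}) (K' : Set (L'.Structure ℕ)), IsFirstOrderClass K' →
      BorelReducible (isoOn K') (isoOn K)

/-! ### The classes of algebras -/

/-- The operation symbols of an algebra: a single binary symbol. -/
inductive AlgebraOp : ℕ → Type
  | star : AlgebraOp 2

/-- The signature with one binary operation symbol. -/
abbrev algebraLang : FirstOrder.Language.{0, 0} := ⟨AlgebraOp, fun _ => Empty⟩

/-- The binary operation of an algebra with underlying set `ℕ`. -/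
def starOp (S : algebraLang.Structure ℕ) (a b : ℕ) : ℕ := S.funMap AlgebraOp.star ![a, b]

/-- Left distributivity. -/
def LeftDistributive {A : Type} (op : A → A → A) : Prop :=
  ∀ a b c, op a (op b c) = op (op a b) (op a c)

/-- Unique solvability: each left multiplication is a bijection. -/
def UniquelySolvable {A : Type} (op : A → A → A) : Prop :=
  ∀ a c, ∃! b, op a b = c

/-- Idempotence. -/
def Idempotent {A : Type} (op : A → A → A) : Prop :=
  ∀ a, op a a = a

/-- Involutivity: each left multiplication is its own inverse. -/
def Involutory {A : Type} (op : A → A → A) : Prop :=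
  ∀ a b, op a (op a b) = b

/-- The class of left distributive algebras on `ℕ`. -/
def leftDistributiveAlgebras : Set (algebraLang.Structure ℕ) :=
  {S | LeftDistributive (starOp S)}

/-- The class of racks on `ℕ`. -/
def racks : Set (algebraLang.Structure ℕ) :=
  {S | LeftDistributive (starOp S) ∧ UniquelySolvable (starOp S)}

/-- The class of quandles on `ℕ`. -/
def quandles : Set (algebraLang.Structure ℕ) :=
  {S | LeftDistributive (starOp S) ∧ UniquelySolvable (starOp S) ∧ Idempotent (starOp S)}

/-- The class of keis on `ℕ`. -/
def keis : Set (algebraLang.Structure ℕ) :=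
  {S | LeftDistributive (starOp S) ∧ UniquelySolvable (starOp S) ∧ Idempotent (starOp S) ∧
    Involutory (starOp S)}

/-- The operation symbols of Laver's identities: two binary symbols `∗` and `∘`. -/
inductive SigmaOp : ℕ → Type
  | star : SigmaOp 2
  | circ : SigmaOp 2

/-- The signature with two binary operation symbols. -/
abbrev sigmaLang : FirstOrder.Language.{0, 0} := ⟨SigmaOp, fun _ => Empty⟩

/-- The operation `∗` of a structure with underlying set `ℕ`. -/
def sigmaStar (S : sigmaLang.Structure ℕ) (a b : ℕ) : ℕ := S.funMap SigmaOp.star ![a, b]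

/-- The operation `∘` of a structure with underlying set `ℕ`. -/
def sigmaCirc (S : sigmaLang.Structure ℕ) (a b : ℕ) : ℕ := S.funMap SigmaOp.circ ![a, b]

/-- Laver's set `Σ` of four identities for a pair of binary operations `∗` and `∘`. -/
structure SatisfiesSigma {A : Type} (ast circ : A → A → A) : Prop where
  circ_assoc : ∀ a b c, circ a (circ b c) = circ (circ a b) c
  circ_ast : ∀ a b c, ast (circ a b) c = ast a (ast b c)
  ast_circ : ∀ a b c, ast a (circ b c) = circ (ast a b) (ast a c)
  ast_circ_self : ∀ a b, circ (ast a b) a = circ a b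

/-- The class of algebras on `ℕ` satisfying `Σ`. -/
def sigmaAlgebras : Set (sigmaLang.Structure ℕ) :=
  {S | SatisfiesSigma (sigmaStar S) (sigmaCirc S)}

end

end CountableModels

/-!
Each class is visibly axiomatised by finitely many sentences. The content is that isomorphism of
arbitrary structures on `ℕ` in a finite signature can be coded, in a Borel (in fact continuous)
way, by isomorphism of keis, and also by isomorphism of algebras satisfying `Σ`. The coding runs
through three intermediate kinds of objects.

* A structure is the same as its set of *facts* `F k l`: the tuple whose list of entries is `l`
  lies in the relation, or in the graph of the operation, numbered `k`. Isomorphism of structures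
  is isomorphism of facts up to a permutation of `ℕ` (`nonempty_equiv_iff_factIso`).
* The facts are coded by a digraph `Arrow F` whose vertices are the elements of `ℕ`, the lists of
  elements, and a rigid sequence of constants, which carry the loops and are ordered like `ℕ`. A
  list points to its head and to its tail, so an isomorphism of such digraphs is determined by its
  action on the elements, and it preserves the facts (`factIso_iff_relIso`).
* A digraph `R` on `X` is coded by a family of nonempty finite sets ("blocks") of points, in which
  an arrow from `x` to `y` appears as the three-element block `{src x, tgt y, apex}`, while the
  blocks `{src x}` and `{src x, tgt x}` identify the points
  (`IncidenceIso.nonempty_relIso`).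

A family of nonempty blocks is coded by a kei. Its elements are the points, and two elements for
each block; a point interchanges the two elements of every block that contains it, and there is no
other action. The points act by commuting involutions, and this is all that left distributivity
asks for. Points are the elements that nothing moves, and the block of any other element is the set
of points that move it, so the family can be recovered (`nonempty_relIso_iff_keiOp`). As every kei
is a quandle, a rack and a left distributive algebra, this settles four of the five classes.

For `Σ`, every commutative semigroup with `a ∗ b = b` satisfies the identities. The family of blocks
is coded by the commutative semigroup consisting of the points, the blocks, a zero and one further
element `one`, in which all products are `zero` except that two blocks, or a point and a block
containing it, have product `one` (`nonempty_relIso_iff_semigroupOp`). Products of three elements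
vanish, which makes associativity trivial.

In each step a single value of the coding object depends on at most one bit of the coded object,
whence the continuity.
-/

namespace CountableModels

/-! ### Structures as sets of facts -/

variable {L : FirstOrder.Language.{0, 0}}

/-- The symbol to which a tuple belongs. -/
def TupleIndex.symbol : TupleIndex L → L.Symbols
  | Sum.inl ⟨g, _⟩ => Sum.inl g
  | Sum.inr ⟨r, _⟩ => Sum.inr r

/-- The entries of a tuple as a list; in a tuple of the graph of an operation the value comes
first. -/
def TupleIndex.entries : TupleIndex L → List ℕ
  | Sum.inl ⟨_, (x, y)⟩ => y :: List.ofFn x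
  | Sum.inr ⟨_, x⟩ => List.ofFn x

/-- The action of a map on tuples, entry by entry. -/
def TupleIndex.map (f : ℕ → ℕ) : TupleIndex L → TupleIndex L
  | Sum.inl ⟨g, (x, y)⟩ => Sum.inl ⟨g, (f ∘ x, f y)⟩
  | Sum.inr ⟨r, x⟩ => Sum.inr ⟨r, f ∘ x⟩

theorem TupleIndex.symbol_map (f : ℕ → ℕ) (t : TupleIndex L) :
    (t.map f).symbol = t.symbol := by
  rcases t with ⟨g, x, y⟩ | ⟨r, x⟩ <;> rfl

theorem TupleIndex.entries_map (f : ℕ → ℕ) (t : TupleIndex L) :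
    (t.map f).entries = t.entries.map f := by
  rcases t with ⟨g, x, y⟩ | ⟨r, x⟩ <;> simp [map, entries, List.map_ofFn]

/-- The symbol determines the kind and the length of a tuple, so nothing is lost in passing to the
list of entries. -/
theorem TupleIndex.ext_symbol_entries {t t' : TupleIndex L} (hs : t.symbol = t'.symbol)
    (he : t.entries = t'.entries) : t = t' := by
  rcases t with ⟨g, x, y⟩ | ⟨r, x⟩ <;> rcases t' with ⟨g', x', y'⟩ | ⟨r', x'⟩
  · obtain rfl : g = g' := Sum.inl_injective hs
    obtain ⟨rfl, hx⟩ := List.cons.inj he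
    rw [List.ofFn_injective hx]
  · cases hs
  · cases hs
  · obtain rfl : r = r' := Sum.inr_injective hs
    rw [List.ofFn_injective he]

theorem nonempty_equiv_iff_code (S S' : L.Structure ℕ) :
    Nonempty (@FirstOrder.Language.Equiv L ℕ ℕ S S') ↔
      ∃ f : ℕ ≃ ℕ, ∀ t, code S t = code S' (TupleIndex.map f t) := by
  constructor
  · rintro ⟨e⟩
    obtain ⟨f, hfun, hrel⟩ := e
    refine ⟨f, ?_⟩
    rintro (⟨⟨n, g⟩, x, y⟩ | ⟨⟨n, r⟩, x⟩)
    · have : S.funMap g x = y ↔ S'.funMap g (f ∘ x) = f y := by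
        rw [← f.apply_eq_iff_eq]
        exact Eq.congr_left (hfun g x)
      simpa [code, TupleIndex.map] using this
    · simpa [code, TupleIndex.map] using (hrel r x).symm
  · rintro ⟨f, hf⟩
    refine ⟨@FirstOrder.Language.Equiv.mk L ℕ ℕ S S' f ?_ ?_⟩
    · intro n g x
      have h := hf (Sum.inl ⟨⟨n, g⟩, x, S.funMap g x⟩)
      exact (by simpa [code, TupleIndex.map] using h :
        S'.funMap g (f ∘ x) = f (S.funMap g x)).symm
    · intro n r x
      have h := hf (Sum.inr ⟨⟨n, r⟩, x⟩)
      exact (by simpa [code, TupleIndex.map] using h :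
        S.RelMap r x ↔ S'.RelMap r (f ∘ x)).symm

/-- `Fact e S k l`: for a numbering `e` of the symbols, the tuple with entries `l` belonging to the
symbol with number `k` exists and holds in `S`. It is false if `k` is not the number of a symbol or
the length of `l` does not match its arity. -/
def Fact (e : L.Symbols → ℕ) (S : L.Structure ℕ) (k : ℕ) (l : List ℕ) : Prop :=
  ∃ t : TupleIndex L, e t.symbol = k ∧ t.entries = l ∧ code S t = true

theorem fact_iff {e : L.Symbols → ℕ} (he : e.Injective) (S : L.Structure ℕ) (t : TupleIndex L) :
    Fact e S (e t.symbol) t.entries ↔ code S t = true := by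
  constructor
  · rintro ⟨t', hs, hl, h⟩
    rwa [← TupleIndex.ext_symbol_entries (he hs) hl]
  · exact fun h => ⟨t, rfl, rfl, h⟩

theorem isClopen_fact {e : L.Symbols → ℕ} (he : e.Injective) (k : ℕ) (l : List ℕ) :
    IsClopen {S : L.Structure ℕ | Fact e S k l} := by
  by_cases h : ∃ t : TupleIndex L, e t.symbol = k ∧ t.entries = l
  · obtain ⟨t, rfl, rfl⟩ := h
    simp only [fact_iff he]
    have hc : Continuous fun S : L.Structure ℕ => code S t :=
      continuous_pi_iff.1 continuous_induced_dom t
    exact (isClopen_discrete {true}).preimage hc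
  · convert isClopen_empty
    ext S
    simp only [Set.mem_ofPred_eq, Set.mem_empty_iff_false, iff_false]
    exact fun ⟨t, hk, hl, _⟩ => h ⟨t, hk, hl⟩

/-- Two sets of facts agree up to a permutation of `ℕ`. -/
def FactIso (F F' : ℕ → List ℕ → Prop) : Prop :=
  ∃ f : ℕ ≃ ℕ, ∀ k l, F k l ↔ F' k (l.map f)

theorem nonempty_equiv_iff_factIso {e : L.Symbols → ℕ} (he : e.Injective)
    (S S' : L.Structure ℕ) :
    Nonempty (@FirstOrder.Language.Equiv L ℕ ℕ S S') ↔ FactIso (Fact e S) (Fact e S') := by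
  rw [nonempty_equiv_iff_code]
  refine exists_congr fun f => ⟨fun h k l => ⟨?_, ?_⟩, fun h t => ?_⟩
  · rintro ⟨t, rfl, rfl, ht⟩
    rw [← TupleIndex.entries_map, ← TupleIndex.symbol_map f, fact_iff he, ← h, ht]
  · rintro ⟨t, rfl, hl, ht⟩
    have hinv : TupleIndex.map f (TupleIndex.map f.symm t) = t := by
      rcases t with ⟨g, x, y⟩ | ⟨r, x⟩ <;> simp [TupleIndex.map, ← Function.comp_assoc]
    refine ⟨t.map f.symm, by rw [TupleIndex.symbol_map], ?_, by rw [h, hinv, ht]⟩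
    rw [TupleIndex.entries_map, hl, List.map_map, f.symm_comp_self, List.map_id]
  · rw [Bool.eq_iff_iff, ← fact_iff he, h, ← TupleIndex.entries_map,
      ← TupleIndex.symbol_map f, fact_iff he]

/-! ### The digraph of a set of facts -/

/-- The vertices of the digraph of a set of facts: the constants `con k`, the elements of the
structure and the lists of elements. -/
inductive Node : Type
  | con (k : ℕ) : Node
  | elem (n : ℕ) : Node
  | list (l : List ℕ) : Node
  deriving Countable

open Node in
/-- The digraph of the set of facts `F`. The constants are ordered like `ℕ` (with loops), which
makes them rigid; `con 0` marks the elements and `con (k + 1)` marks the lists `l` with `F k l`; a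
nonempty list points to its head and to its tail. -/
inductive Arrow (F : ℕ → List ℕ → Prop) : Node → Node → Prop
  | con_con {j k : ℕ} (h : j ≤ k) : Arrow F (con j) (con k)
  | con_elem (n : ℕ) : Arrow F (con 0) (elem n)
  | con_list {k : ℕ} {l : List ℕ} (h : F k l) : Arrow F (con (k + 1)) (list l)
  | head (a : ℕ) (l : List ℕ) : Arrow F (list (a :: l)) (elem a)
  | tail (a : ℕ) (l : List ℕ) : Arrow F (list (a :: l)) (list l)

section
variable {F F' : ℕ → List ℕ → Prop}
open Node

theorem arrow_con_list_iff (k : ℕ) (l : List ℕ) : Arrow F (con (k + 1)) (list l) ↔ F k l :=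
  ⟨fun h => by cases h; assumption, .con_list⟩

theorem arrow_con_con_iff (j k : ℕ) : Arrow F (con j) (con k) ↔ j ≤ k :=
  ⟨fun h => by cases h; assumption, .con_con⟩

theorem arrow_self_iff (x : Node) : Arrow F x x ↔ ∃ k, x = con k := by
  constructor
  · intro h
    cases x with
    | con k => exact ⟨k, rfl⟩
    | elem n => cases h
    | list l =>
      -- The indices are generalized since `l = a :: l` is refuted only by comparing lengths.
      generalize hl : list l = y at h
      generalize hl' : y = z at h
      cases h
      all_goals simp_all
  · rintro ⟨k, rfl⟩
    exact .con_con le_rfl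

theorem exists_elem_iff (x : Node) :
    (∃ n, x = elem n) ↔ Arrow F (con 0) x ∧ ¬ Arrow F x x := by
  cases x with
  | con k => simp [arrow_self_iff]
  | elem n => simp [arrow_self_iff, Arrow.con_elem]
  | list l => 
    simp only [reduceCtorEq, exists_false, arrow_self_iff, not_false_eq_true, and_true, false_iff]
    rintro ⟨⟩

/-- The loops sit exactly at the constants, and these are well-ordered, so isomorphisms fix them. -/
theorem relIso_con (h : Arrow F ≃r Arrow F') (k : ℕ) : h (con k) = con k := by
  have hcon (F F' : ℕ → List ℕ → Prop) (h : Arrow F ≃r Arrow F') (k : ℕ) :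
      ∃ k', h (con k) = con k' := by
    rw [← arrow_self_iff (F := F'), h.map_rel_iff, arrow_self_iff]
    exact ⟨k, rfl⟩
  choose σ hσ using hcon F F' h
  choose τ hτ using hcon F' F h.symm
  let s : ℕ ≃o ℕ :=
    { toFun := σ
      invFun := τ
      left_inv := fun k => Node.con.inj (by rw [← hτ, ← hσ, h.symm_apply_apply])
      right_inv := fun k => Node.con.inj (by rw [← hσ, ← hτ, h.apply_symm_apply])
      map_rel_iff' := fun {j k} => by
        change σ j ≤ σ k ↔ _
        rw [← arrow_con_con_iff (F := F'), ← hσ, ← hσ, h.map_rel_iff, arrow_con_con_iff] }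
  -- The well-order `ℕ` is rigid.
  have hs : s = OrderIso.refl ℕ := Subsingleton.elim _ _
  rw [hσ]
  exact congrArg con (DFunLike.congr_fun hs k)

theorem relIso_elem (h : Arrow F ≃r Arrow F') :
    ∃ f : ℕ ≃ ℕ, ∀ n, h (elem n) = elem (f n) := by
  have helem (F F' : ℕ → List ℕ → Prop) (h : Arrow F ≃r Arrow F') (n : ℕ) :
      ∃ n', h (elem n) = elem n' := by
    rw [exists_elem_iff (F := F'), h.map_rel_iff, ← relIso_con h 0, h.map_rel_iff,
      ← exists_elem_iff]
    exact ⟨n, rfl⟩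
  choose f hf using helem F F' h
  choose g hg using helem F' F h.symm
  exact ⟨⟨f, g, fun n => Node.elem.inj (by rw [← hg, ← hf, h.symm_apply_apply]),
    fun n => Node.elem.inj (by rw [← hf, ← hg, h.apply_symm_apply])⟩, hf⟩

theorem relIso_list (h : Arrow F ≃r Arrow F') {f : ℕ ≃ ℕ} (hf : ∀ n, h (elem n) = elem (f n))
    (l : List ℕ) : h (list l) = list (l.map f) := by
  have hlist (l : List ℕ) : ∃ m, h (list l) = list m := by
    cases hx : h (list l) with
    | con k => rw [← relIso_con h, h.injective.eq_iff] at hx; cases hx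
    | elem n =>
      rw [← f.apply_symm_apply n, ← hf, h.injective.eq_iff] at hx; cases hx
    | list m => exact ⟨m, rfl⟩
  induction l with
  | nil =>
    obtain ⟨m, hm⟩ := hlist []
    cases m with
    | nil => exact hm
    | cons a m =>
      have := Arrow.head (F := F') a m
      rw [← hm, ← f.apply_symm_apply a, ← hf, h.map_rel_iff] at this
      cases this
  | cons a l ih =>
    obtain ⟨m, hm⟩ := hlist (a :: l)
    have h1 := h.map_rel_iff.2 (Arrow.head (F := F) a l)
    have h2 := h.map_rel_iff.2 (Arrow.tail (F := F) a l)
    rw [hm, hf] at h1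
    rw [hm, ih] at h2
    cases h1
    cases h2
    exact hm

/-- The bijection of vertices induced by a permutation of the elements. -/
def Node.map (f : ℕ ≃ ℕ) : Node ≃ Node where
  toFun
    | con k => con k
    | elem n => elem (f n)
    | list l => list (l.map f)
  invFun
    | con k => con k
    | elem n => elem (f.symm n)
    | list l => list (l.map f.symm)
  left_inv x := by cases x <;> simp
  right_inv x := by cases x <;> simp

theorem Arrow.map {f : ℕ ≃ ℕ} (hf : ∀ k l, F k l → F' k (l.map f)) {x y : Node}
    (h : Arrow F x y) : Arrow F' (Node.map f x) (Node.map f y) := by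
  cases h with
  | con_con h => exact .con_con h
  | con_elem n => exact .con_elem _
  | con_list h => exact .con_list (hf _ _ h)
  | head a l => exact .head _ _
  | tail a l => exact .tail _ _

theorem factIso_iff_relIso : FactIso F F' ↔ Nonempty (Arrow F ≃r Arrow F') := by
  constructor
  · rintro ⟨f, hf⟩
    refine ⟨⟨Node.map f, fun {x y} => ⟨fun h => ?_, Arrow.map fun k l => (hf k l).1⟩⟩⟩
    have := Arrow.map (f := f.symm) (F' := F) (fun k l h => (hf _ _).2 (by simpa using h)) h
    change Arrow F ((Node.map f).symm _) ((Node.map f).symm _) at this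
    simpa using this
  · rintro ⟨h⟩
    obtain ⟨f, hf⟩ := relIso_elem h
    refine ⟨f, fun k l => ?_⟩
    rw [← arrow_con_list_iff (F := F), ← h.map_rel_iff, relIso_con, relIso_list h hf,
      arrow_con_list_iff]

theorem isClopen_arrow {Ω : Type} [TopologicalSpace Ω] {F : Ω → ℕ → List ℕ → Prop}
    (hF : ∀ k l, IsClopen {ω | F ω k l}) (x y : Node) : IsClopen {ω | Arrow (F ω) x y} := by
  by_cases h : ∃ k l, x = con (k + 1) ∧ y = list l
  · obtain ⟨k, l, rfl, rfl⟩ := h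
    convert hF k l using 3
    exact arrow_con_list_iff _ _
  · have hconst (ω ω' : Ω) (hx : Arrow (F ω) x y) : Arrow (F ω') x y := by
      cases hx with
      | con_con hjk => exact .con_con hjk
      | con_elem n => exact .con_elem n
      | con_list _ => exact absurd ⟨_, _, rfl, rfl⟩ h
      | head a l => exact .head a l
      | tail a l => exact .tail a l
    by_cases hω : ∃ ω, Arrow (F ω) x y
    · obtain ⟨ω, hω⟩ := hω
      convert isClopen_univ
      exact Set.eq_univ_of_forall fun ω' => hconst ω ω' hω
    · push Not at hω
      convert isClopen_empty
      exact Set.eq_empty_of_forall_notMem hω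
end

/-! ### The blocks of a digraph -/

/-- The points of the incidence structure of a digraph on `X`: two copies of each vertex, and one
additional point. -/
inductive Point (X : Type) : Type
  | src (x : X) : Point X
  | tgt (x : X) : Point X
  | apex : Point X
  deriving Countable

/-- Indices for the blocks of the incidence structure of a digraph on `X`. -/
inductive Block (X : Type) : Type
  | single (x : X) : Block X
  | link (x : X) : Block X
  | arc (x y : X) : Block X
  deriving Countable

section
variable {X Y : Type} {R : X → X → Prop} {R' : Y → Y → Prop}
open Point Block

/-- Membership of a point in a block. The block `arc x y` is `{src x, tgt y, apex}` if there is an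
arrow from `x` to `y`; otherwise it is `{src x}`, which is a block anyway, so that the index set
does not depend on `R`. -/
def Incident (R : X → X → Prop) (b : Point X) : Block X → Prop
  | single x => b = src x
  | link x => b = src x ∨ b = tgt x
  | arc x y => b = src x ∨ R x y ∧ (b = tgt y ∨ b = apex)

/-- The bijection `f` of points maps the family of blocks of `R` onto that of `R'`, where the
multiplicity of a block is disregarded. -/
def IncidenceIso (R : X → X → Prop) (R' : Y → Y → Prop) (f : Point X ≃ Point Y) : Prop :=
  (∀ i, ∃ i', ∀ b, Incident R b i ↔ Incident R' (f b) i') ∧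
    ∀ i', ∃ i, ∀ b, Incident R b i ↔ Incident R' (f b) i'

theorem IncidenceIso.symm {f : Point X ≃ Point Y} (h : IncidenceIso R R' f) :
    IncidenceIso R' R f.symm := by
  refine ⟨fun i => ?_, fun i => ?_⟩
  · obtain ⟨j, hj⟩ := h.2 i
    exact ⟨j, fun b => by rw [hj, f.apply_symm_apply]⟩
  · obtain ⟨j, hj⟩ := h.1 i
    exact ⟨j, fun b => by rw [hj, f.apply_symm_apply]⟩

theorem exists_incident (i : Block X) : ∃ b, Incident R b i := by
  cases i with
  | single x => exact ⟨src x, rfl⟩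
  | link x => exact ⟨src x, .inl rfl⟩
  | arc x y => exact ⟨src x, .inl rfl⟩

/-- The points `src x` are those which form a block by themselves. -/
theorem exists_src_iff (R : X → X → Prop) (b : Point X) :
    (∃ x, b = src x) ↔ ∃ i, ∀ c, Incident R c i ↔ c = b := by
  constructor
  · rintro ⟨x, rfl⟩
    exact ⟨single x, fun c => Iff.rfl⟩
  · rintro ⟨i, hi⟩
    cases i with
    | single x => exact ⟨x, ((hi _).1 rfl).symm⟩
    | link x => exact ⟨x, ((hi _).1 (.inl rfl)).symm⟩
    | arc x y => exact ⟨x, ((hi _).1 (.inl rfl)).symm⟩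

/-- The point `tgt x` is the only one that forms a two-element block with `src x`. -/
theorem eq_tgt_iff (R : X → X → Prop) (x : X) (b : Point X) :
    b = tgt x ↔ b ≠ src x ∧ ∃ i, ∀ c, Incident R c i ↔ c = src x ∨ c = b := by
  constructor
  · rintro rfl
    exact ⟨nofun, link x, fun c => Iff.rfl⟩
  · rintro ⟨hb, i, hi⟩
    cases i with
    | single y => grind [Incident, hi (src x), hi b]
    | link y => grind [Incident, hi (src y), hi (tgt y)]
    | arc y z => grind [Incident, hi (src x), hi b, hi (tgt z), hi apex]

theorem rel_iff_exists_block (x y : X) :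
    R x y ↔ ∃ i, Incident R (src x) i ∧ Incident R (tgt y) i ∧ Incident R apex i := by
  constructor
  · intro h
    exact ⟨arc x y, .inl rfl, .inr ⟨h, .inl rfl⟩, .inr ⟨h, .inr rfl⟩⟩
  · rintro ⟨i, h⟩
    cases i <;> simp_all [Incident]

theorem IncidenceIso.exists_src {f : Point X ≃ Point Y} (h : IncidenceIso R R' f) (x : X) :
    ∃ y, f (src x) = src y := by
  rw [exists_src_iff R']
  obtain ⟨j, hj⟩ := h.1 (single x)
  exact ⟨j, fun c => by
    rw [← f.apply_symm_apply c, ← hj, f.apply_eq_iff_eq]; rfl⟩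

theorem IncidenceIso.nonempty_relIso {f : Point X ≃ Point Y} (h : IncidenceIso R R' f) :
    Nonempty (R ≃r R') := by
  choose φ hφ using h.exists_src
  choose ψ hψ using h.symm.exists_src
  let e : X ≃ Y := ⟨φ, ψ, fun x => Point.src.inj (by rw [← hψ, ← hφ, f.symm_apply_apply]),
    fun x => Point.src.inj (by rw [← hφ, ← hψ, f.apply_symm_apply])⟩
  have hsrc (x : X) : f (src x) = src (e x) := hφ x
  have htgt (x : X) : f (tgt x) = tgt (e x) := by
    rw [eq_tgt_iff R', ← hsrc, f.injective.ne_iff]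
    obtain ⟨j, hj⟩ := h.1 (link x)
    refine ⟨nofun, j, fun c => ?_⟩
    rw [← f.apply_symm_apply c, ← hj, f.apply_eq_iff_eq, f.apply_eq_iff_eq]; rfl
  have hapex : f apex = apex := by
    cases hb : f apex with
    | src y => rw [← e.apply_symm_apply y, ← hsrc, f.apply_eq_iff_eq] at hb; cases hb
    | tgt y => rw [← e.apply_symm_apply y, ← htgt, f.apply_eq_iff_eq] at hb; cases hb
    | apex => rfl
  refine ⟨⟨e, fun {x y} => ?_⟩⟩
  rw [rel_iff_exists_block (R := R), rel_iff_exists_block (R := R'), ← hsrc, ← htgt, ← hapex]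
  constructor
  · rintro ⟨i, hi⟩
    obtain ⟨j, hj⟩ := h.2 i
    exact ⟨j, by simpa only [hj] using hi⟩
  · rintro ⟨i, hi⟩
    obtain ⟨j, hj⟩ := h.1 i
    exact ⟨j, by simpa only [← hj] using hi⟩

/-- The bijection of points induced by a bijection of vertices. -/
def Point.map (e : X ≃ Y) : Point X ≃ Point Y where
  toFun
    | src x => src (e x)
    | tgt x => tgt (e x)
    | apex => apex
  invFun
    | src x => src (e.symm x)
    | tgt x => tgt (e.symm x)
    | apex => apex
  left_inv b := by cases b <;> simp
  right_inv b := by cases b <;> simp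

/-- The bijection of blocks induced by a bijection of vertices. -/
def Block.map (e : X ≃ Y) : Block X ≃ Block Y where
  toFun
    | single x => single (e x)
    | link x => link (e x)
    | arc x y => arc (e x) (e y)
  invFun
    | single x => single (e.symm x)
    | link x => link (e.symm x)
    | arc x y => arc (e.symm x) (e.symm y)
  left_inv b := by cases b <;> simp
  right_inv b := by cases b <;> simp

theorem incident_map (e : R ≃r R') (b : Point X) (i : Block X) :
    Incident R' (Point.map e.toEquiv b) (Block.map e.toEquiv i) ↔ Incident R b i := by
  cases i <;> cases b <;> simp [Incident, Point.map, Block.map, e.map_rel_iff]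

theorem isClopen_const {Ω : Type} [TopologicalSpace Ω] (p : Prop) : IsClopen {_ω : Ω | p} := by
  by_cases hp : p <;> simp [hp, isClopen_empty, isClopen_univ]

theorem isClopen_incident {Ω : Type} [TopologicalSpace Ω] {R : Ω → X → X → Prop}
    (hR : ∀ x y, IsClopen {ω | R ω x y}) (b : Point X) (i : Block X) :
    IsClopen {ω | Incident (R ω) b i} := by
  cases i with
  | single x => exact isClopen_const _
  | link x => exact isClopen_const _
  | arc x y => exact (isClopen_const _).union ((hR x y).inter (isClopen_const _))

/-! ### The kei of a digraph -/

/-- The elements of the kei of a digraph: the points, and two elements for each block. -/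
abbrev KeiCarrier (X : Type) : Type := Point X ⊕ Block X × Bool

open Classical in
/-- The operation of the kei of a digraph: a point interchanges the two elements of each block
containing it and fixes all other elements; the elements of blocks act trivially. -/
noncomputable def keiOp (R : X → X → Prop) : KeiCarrier X → KeiCarrier X → KeiCarrier X
  | .inl b, .inr (i, ε) => .inr (i, xor ε (decide (Incident R b i)))
  | _, c => c

theorem leftDistributive_keiOp : LeftDistributive (keiOp R) := by
  rintro (a | ⟨i, ε⟩) (b | ⟨j, δ⟩) (c | ⟨k, γ⟩) <;> simp [keiOp]
  grind

theorem involutory_keiOp : Involutory (keiOp R) := by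
  rintro (a | ⟨i, ε⟩) (b | ⟨j, δ⟩) <;> simp [keiOp]

theorem idempotent_keiOp : Idempotent (keiOp R) := by
  rintro (a | ⟨i, ε⟩) <;> simp [keiOp]

theorem Involutory.uniquelySolvable {A : Type} {op : A → A → A} (h : Involutory op) :
    UniquelySolvable op :=
  fun a c => ⟨op a c, h a c, fun b hb => by rw [← hb, h]⟩

/-- The bijection `h` is an isomorphism between two binary operations. -/
def OpIso {A B : Type} (op : A → A → A) (op' : B → B → B) (h : A ≃ B) : Prop :=
  ∀ a b, h (op a b) = op' (h a) (h b)

theorem OpIso.symm {A B : Type} {op : A → A → A} {op' : B → B → B} {h : A ≃ B}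
    (H : OpIso op op' h) : OpIso op' op h.symm := fun a b => by
  rw [h.symm_apply_eq, H, h.apply_symm_apply, h.apply_symm_apply]

/-- The points are the elements which are moved by no element, because every block is nonempty. -/
theorem exists_inl_iff (x : KeiCarrier X) : (∃ b, x = .inl b) ↔ ∀ a, keiOp R a x = x := by
  rcases x with b | ⟨i, ε⟩
  · simp [keiOp]
  · obtain ⟨b, hb⟩ := exists_incident (R := R) i
    simp only [reduceCtorEq, exists_false, false_iff, not_forall]
    exact ⟨.inl b, by simp [keiOp, hb]⟩

theorem incident_iff_keiOp_ne (b : Point X) (i : Block X) (ε : Bool) :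
    Incident R b i ↔ keiOp R (.inl b) (.inr (i, ε)) ≠ .inr (i, ε) := by
  cases ε <;> simp [keiOp]

theorem nonempty_relIso_iff_keiOp :
    Nonempty (R ≃r R') ↔ ∃ h, OpIso (keiOp R) (keiOp R') h := by
  constructor
  · rintro ⟨e⟩
    refine ⟨(Point.map e.toEquiv).sumCongr ((Block.map e.toEquiv).prodCongr (.refl Bool)), ?_⟩
    rintro (a | ⟨i, ε⟩) (b | ⟨j, δ⟩) <;> simp [keiOp, incident_map]
  · rintro ⟨h, H⟩
    have hinl {X Y : Type} {R : X → X → Prop} {R' : Y → Y → Prop}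
        {h : KeiCarrier X ≃ KeiCarrier Y} (H : OpIso (keiOp R) (keiOp R') h) (b : Point X) :
        ∃ b', h (.inl b) = .inl b' := by
      rw [exists_inl_iff (R := R')]
      intro a
      rw [← h.apply_symm_apply a, ← H, (exists_inl_iff (R := R) _).1 ⟨b, rfl⟩]
    choose f hf using hinl H
    choose g hg using hinl H.symm
    let F : Point X ≃ Point Y :=
      ⟨f, g, fun b => Sum.inl_injective (by rw [← hg, ← hf, h.symm_apply_apply]),
        fun b => Sum.inl_injective (by rw [← hf, ← hg, h.apply_symm_apply])⟩
    have hF (b : Point X) : h (.inl b) = .inl (F b) := hf b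
    have key (i : Block X) (ε : Bool) (i' : Block Y) (ε' : Bool)
        (hi : h (.inr (i, ε)) = .inr (i', ε')) (b : Point X) :
        Incident R b i ↔ Incident R' (F b) i' := by
      rw [incident_iff_keiOp_ne b i ε, incident_iff_keiOp_ne (F b) i' ε', ← hF, ← hi, ← H,
        h.injective.ne_iff]
    refine IncidenceIso.nonempty_relIso (f := F) ⟨fun i => ?_, fun i' => ?_⟩
    · rcases hi : h (.inr (i, false)) with b | ⟨i', ε'⟩
      · rw [← F.apply_symm_apply b, ← hF, h.apply_eq_iff_eq] at hi
        cases hi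
      · exact ⟨i', key _ _ _ _ hi⟩
    · rcases hi : h.symm (.inr (i', false)) with b | ⟨i, ε⟩
      · rw [h.symm_apply_eq, hF] at hi
        cases hi
      · exact ⟨i, key _ _ _ _ ((h.symm_apply_eq.1 hi).symm)⟩

theorem isClopen_keiOp {Ω : Type} [TopologicalSpace Ω] {R : Ω → X → X → Prop}
    (hR : ∀ x y, IsClopen {ω | R ω x y}) (a b c : KeiCarrier X) :
    IsClopen {ω | keiOp (R ω) a b = c} := by
  rcases a with a | i
  · rcases b with b | ⟨j, ε⟩
    · exact isClopen_const (.inl b = c)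
    · have hD := isClopen_incident hR a j
      have : {ω | keiOp (R ω) (.inl a) (.inr (j, ε)) = c} =
          {ω | Incident (R ω) a j} ∩ {_ω | .inr (j, !ε) = c} ∪
          {ω | Incident (R ω) a j}ᶜ ∩ {_ω | .inr (j, ε) = c} := by
        ext ω
        by_cases hω : Incident (R ω) a j <;> simp [keiOp, hω]
      rw [this]
      exact (hD.inter (isClopen_const _)).union (hD.compl.inter (isClopen_const _))
  · exact isClopen_const (b = c)

/-! ### The commutative semigroup of a digraph -/

/-- The elements of the commutative semigroup of a digraph. -/
inductive SemigroupCarrier (X : Type) : Type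
  | pt (b : Point X) : SemigroupCarrier X
  | blk (i : Block X) : SemigroupCarrier X
  | one : SemigroupCarrier X
  | zero : SemigroupCarrier X
  deriving Countable

open SemigroupCarrier

open Classical in
/-- The product in the commutative semigroup of a digraph: it is `one` for two blocks and for a
point and a block containing it, and `zero` in all other cases. -/
noncomputable def semigroupOp (R : X → X → Prop) :
    SemigroupCarrier X → SemigroupCarrier X → SemigroupCarrier X
  | blk _, blk _ => one
  | pt b, blk i => if Incident R b i then one else zero
  | blk i, pt b => if Incident R b i then one else zero
  | _, _ => zero

theorem semigroupOp_eq (R : X → X → Prop) (x y : SemigroupCarrier X) :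
    semigroupOp R x y = one ∨ semigroupOp R x y = zero := by
  cases x <;> cases y <;> simp only [semigroupOp, or_true, true_or] <;> split_ifs <;> simp

theorem semigroupOp_comm (x y : SemigroupCarrier X) :
    semigroupOp R x y = semigroupOp R y x := by
  cases x <;> cases y <;> rfl

theorem semigroupOp_op (x y z : SemigroupCarrier X) :
    semigroupOp R x (semigroupOp R y z) = zero := by
  rcases semigroupOp_eq R y z with h | h <;> rw [h] <;> cases x <;> rfl

theorem semigroupOp_assoc (x y z : SemigroupCarrier X) :
    semigroupOp R x (semigroupOp R y z) = semigroupOp R (semigroupOp R x y) z := by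
  rw [semigroupOp_op, semigroupOp_comm, semigroupOp_op]

theorem satisfiesSigma_of_comm_assoc {A : Type} {op : A → A → A}
    (hcomm : ∀ a b, op a b = op b a) (hassoc : ∀ a b c, op a (op b c) = op (op a b) c) :
    SatisfiesSigma (fun _ b => b) op where
  circ_assoc := hassoc
  circ_ast _ _ _ := rfl
  ast_circ _ _ _ := rfl
  ast_circ_self a b := hcomm b a

theorem nonempty_relIso_iff_semigroupOp [Nonempty X] :
    Nonempty (R ≃r R') ↔ ∃ h, OpIso (semigroupOp R) (semigroupOp R') h := by
  constructor
  · rintro ⟨e⟩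
    refine ⟨⟨fun
        | pt b => pt (Point.map e.toEquiv b)
        | blk i => blk (Block.map e.toEquiv i)
        | one => one
        | zero => zero, fun
        | pt b => pt ((Point.map e.toEquiv).symm b)
        | blk i => blk ((Block.map e.toEquiv).symm i)
        | one => one
        | zero => zero, fun x => by cases x <;> simp, fun x => by cases x <;> simp⟩, ?_⟩
    intro x y
    cases x <;> cases y <;> simp only [semigroupOp, Equiv.coe_fn_mk, incident_map] <;>
      split_ifs <;> simp_all [incident_map]
  · rintro ⟨h, H⟩
    -- `zero` is a product of three elements, and these all vanish.
    have hzero : h zero = zero := by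
      have : semigroupOp R zero (semigroupOp R zero zero) = zero := rfl
      rw [← this, H, H, semigroupOp_op]
    -- `one` is the only other product.
    have hone : h one = one := by
      obtain ⟨x⟩ := ‹Nonempty X›
      have : semigroupOp R (blk (.single x)) (blk (.single x)) = one := rfl
      refine (semigroupOp_eq R' (h (blk (.single x))) (h (blk (.single x)))).elim ?_ ?_ <;>
        rw [← H, this]
      · exact id
      · rw [← hzero, h.apply_eq_iff_eq]
        nofun
    -- The blocks are the elements whose square is `one`.
    have hblk' {X : Type} (R : X → X → Prop) (x : SemigroupCarrier X) :
        (∃ i, x = blk i) ↔ semigroupOp R x x = one := by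
      cases x <;> simp [semigroupOp]
    have hblk (i : Block X) : ∃ i', h (blk i) = blk i' := by
      rw [hblk' R', ← H, ← hone, (hblk' R _).1 ⟨i, rfl⟩]
    have hblk_symm (i' : Block Y) : ∃ i, h (blk i) = blk i' := by
      obtain ⟨i, hi⟩ : ∃ i, h.symm (blk i') = blk i := by
        rw [hblk' R, ← h.apply_eq_iff_eq, H, h.apply_symm_apply, hone]
        rfl
      exact ⟨i, by rw [← hi, h.apply_symm_apply]⟩
    have hpt (b : Point X) : ∃ b', h (pt b) = pt b' := by
      cases hb : h (pt b) with
      | pt b' => exact ⟨b', rfl⟩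
      | blk i =>
        obtain ⟨j, hj⟩ := hblk_symm i
        rw [← hj, h.apply_eq_iff_eq] at hb
        cases hb
      | one => rw [← hone, h.apply_eq_iff_eq] at hb; cases hb
      | zero => rw [← hzero, h.apply_eq_iff_eq] at hb; cases hb
    have hpt_symm (b' : Point Y) : ∃ b, h (pt b) = pt b' := by
      obtain ⟨x, hx⟩ := h.surjective (pt b')
      cases x with
      | pt b => exact ⟨b, hx⟩
      | blk i =>
        obtain ⟨j, hj⟩ := hblk i
        rw [hj] at hx
        cases hx
      | one => rw [hone] at hx; cases hx
      | zero => rw [hzero] at hx; cases hx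
    choose f hf using hpt
    let F : Point X ≃ Point Y := Equiv.ofBijective f
      ⟨fun b c hbc => by
        have : h (pt b) = h (pt c) := by rw [hf, hf, hbc]
        exact SemigroupCarrier.pt.inj (h.injective this),
      fun b' => by
        obtain ⟨b, hb⟩ := hpt_symm b'
        exact ⟨b, SemigroupCarrier.pt.inj (by rw [← hf, hb])⟩⟩
    have hinc {X : Type} (R : X → X → Prop) (b : Point X) (i : Block X) :
        Incident R b i ↔ semigroupOp R (pt b) (blk i) = one := by
      simp [semigroupOp]
    have key (i : Block X) (i' : Block Y) (hi : h (blk i) = blk i') (b : Point X) :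
        Incident R b i ↔ Incident R' (F b) i' := by
      have hF : h (pt b) = pt (F b) := hf b
      rw [hinc, hinc, ← hF, ← hi, ← H, ← hone, h.apply_eq_iff_eq]
    refine IncidenceIso.nonempty_relIso (f := F) ⟨fun i => ?_, fun i' => ?_⟩
    · obtain ⟨i', hi⟩ := hblk i
      exact ⟨i', key i i' hi⟩
    · obtain ⟨i, hi⟩ := hblk_symm i'
      exact ⟨i, key i i' hi⟩

theorem isClopen_semigroupOp {Ω : Type} [TopologicalSpace Ω] {R : Ω → X → X → Prop}
    (hR : ∀ x y, IsClopen {ω | R ω x y}) (a b c : SemigroupCarrier X) :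
    IsClopen {ω | semigroupOp (R ω) a b = c} := by
  have hite (b : Point X) (i : Block X) :
      IsClopen {ω | semigroupOp (R ω) (pt b) (blk i) = c} := by
    have hD := isClopen_incident hR b i
    have : {ω | semigroupOp (R ω) (pt b) (blk i) = c} =
        {ω | Incident (R ω) b i} ∩ {_ω | one = c} ∪
        {ω | Incident (R ω) b i}ᶜ ∩ {_ω | zero = c} := by
      ext ω
      by_cases hω : Incident (R ω) b i <;> simp [semigroupOp, hω]
    rw [this]
    exact (hD.inter (isClopen_const _)).union (hD.compl.inter (isClopen_const _))
  -- Only the product of a point and a block, in either order, depends on `ω`.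
  cases a <;> cases b <;> first
    | exact hite _ _
    | exact isClopen_const (zero = c)
    | exact isClopen_const (one = c)

end

/-! ### Structures on `ℕ` from binary operations -/

/-- The algebra on `ℕ` with a given binary operation. -/
abbrev algebraOf (op : ℕ → ℕ → ℕ) : algebraLang.Structure ℕ where
  funMap := fun
    | .star, x => op (x 0) (x 1)
  RelMap := nofun

/-- The structure on `ℕ` with given operations `∗` and `∘`. -/
abbrev sigmaOf (ast circ : ℕ → ℕ → ℕ) : sigmaLang.Structure ℕ where
  funMap := fun
    | .star, x => ast (x 0) (x 1)
    | .circ, x => circ (x 0) (x 1)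
  RelMap := nofun

theorem nonempty_equiv_algebraOf (op op' : ℕ → ℕ → ℕ) :
    Nonempty (@FirstOrder.Language.Equiv algebraLang ℕ ℕ (algebraOf op) (algebraOf op')) ↔
      ∃ h : ℕ ≃ ℕ, OpIso op op' h := by
  constructor
  · rintro ⟨h, hfun, -⟩
    exact ⟨h, fun a b => hfun AlgebraOp.star ![a, b]⟩
  · rintro ⟨h, H⟩
    refine ⟨@FirstOrder.Language.Equiv.mk algebraLang ℕ ℕ (algebraOf op) (algebraOf op') h ?_
      nofun⟩
    rintro _ ⟨⟩ x
    exact H _ _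

theorem nonempty_equiv_sigmaOf (op op' : ℕ → ℕ → ℕ) :
    Nonempty (@FirstOrder.Language.Equiv sigmaLang ℕ ℕ
      (sigmaOf (fun _ b => b) op) (sigmaOf (fun _ b => b) op')) ↔
      ∃ h : ℕ ≃ ℕ, OpIso op op' h := by
  constructor
  · rintro ⟨h, hfun, -⟩
    exact ⟨h, fun a b => hfun SigmaOp.circ ![a, b]⟩
  · rintro ⟨h, H⟩
    refine ⟨@FirstOrder.Language.Equiv.mk sigmaLang ℕ ℕ
      (sigmaOf (fun _ b => b) op) (sigmaOf (fun _ b => b) op') h ?_ nofun⟩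
    rintro _ (_ | _) x
    · rfl
    · exact H _ _

theorem continuous_decide {Ω : Type} [TopologicalSpace Ω] {P : Ω → Prop}
    [∀ ω, Decidable (P ω)] (hP : IsClopen {ω | P ω}) : Continuous fun ω => decide (P ω) := by
  rw [continuous_bool_rng true]
  convert hP
  ext ω
  simp

theorem continuous_algebraOf {Ω : Type} [TopologicalSpace Ω] {op : Ω → ℕ → ℕ → ℕ}
    (h : ∀ a b c, IsClopen {ω | op ω a b = c}) : Continuous fun ω => algebraOf (op ω) := by
  refine continuous_induced_rng.2 (continuous_pi ?_)
  rintro (⟨⟨_, ⟨⟩⟩, x, y⟩ | ⟨⟨_, ⟨⟩⟩, _⟩)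
  exact continuous_decide (h _ _ _)

theorem continuous_sigmaOf {Ω : Type} [TopologicalSpace Ω] {op : Ω → ℕ → ℕ → ℕ}
    (h : ∀ a b c, IsClopen {ω | op ω a b = c}) :
    Continuous fun ω => sigmaOf (fun _ b => b) (op ω) := by
  refine continuous_induced_rng.2 (continuous_pi ?_)
  rintro (⟨⟨_, (⟨⟩ | ⟨⟩)⟩, x, y⟩ | ⟨⟨_, ⟨⟩⟩, _⟩)
  · exact continuous_decide (isClopen_const (x 1 = y))
  · exact continuous_decide (h _ _ _)

section Transport
variable {A : Type} (e : A ≃ ℕ)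

/-- The operation on `ℕ` obtained by transport along a bijection. -/
def transportOp (op : A → A → A) (a b : ℕ) : ℕ := e (op (e.symm a) (e.symm b))

variable {e}

theorem exists_opIso_transportOp_iff (op op' : A → A → A) :
    (∃ h, OpIso (transportOp e op) (transportOp e op') h) ↔ ∃ h, OpIso op op' h := by
  constructor
  · rintro ⟨h, H⟩
    refine ⟨(e.trans h).trans e.symm, fun a b => ?_⟩
    have := H (e a) (e b)
    simp only [transportOp, Equiv.symm_apply_apply] at this
    simp [this]
  · rintro ⟨h, H⟩
    refine ⟨(e.symm.trans h).trans e, fun a b => ?_⟩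
    simp [transportOp, H _ _]

theorem LeftDistributive.transportOp {op : A → A → A} (h : LeftDistributive op) :
    LeftDistributive (transportOp e op) := fun a b c => by
  simp [CountableModels.transportOp, ← h (e.symm a)]

theorem Idempotent.transportOp {op : A → A → A} (h : Idempotent op) :
    Idempotent (transportOp e op) := fun a => by
  simp [CountableModels.transportOp, h (e.symm a)]

theorem Involutory.transportOp {op : A → A → A} (h : Involutory op) :
    Involutory (transportOp e op) := fun a b => by
  simp [CountableModels.transportOp, h (e.symm a)]

theorem isClopen_transportOp {Ω : Type} [TopologicalSpace Ω] {op : Ω → A → A → A}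
    (h : ∀ a b c, IsClopen {ω | op ω a b = c}) (a b c : ℕ) :
    IsClopen {ω | transportOp e (op ω) a b = c} := by
  convert h (e.symm a) (e.symm b) (e.symm c) using 3
  exact e.eq_symm_apply.symm
end Transport

/-! ### Axiomatisations of the classes -/
section
open FirstOrder FirstOrder.Language
local infixl:80 " ∗ₜ " => Functions.apply₂ (L := algebraLang) AlgebraOp.star

/-- Left distributivity as a sentence. -/
def leftDistributiveSentence : algebraLang.Sentence :=
  ∀' ∀' ∀' ((&0 ∗ₜ (&1 ∗ₜ &2)) =' ((&0 ∗ₜ &1) ∗ₜ (&0 ∗ₜ &2)))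

/-- Unique solvability as a sentence. -/
def uniquelySolvableSentence : algebraLang.Sentence :=
  ∀' ∀' ∃' (((&0 ∗ₜ &2) =' &1) ⊓ ∀' (((&0 ∗ₜ &3) =' &1) ⟹ (&3 =' &2)))

/-- Idempotence as a sentence. -/
def idempotentSentence : algebraLang.Sentence := ∀' ((&0 ∗ₜ &0) =' &0)

/-- Involutivity as a sentence. -/
def involutorySentence : algebraLang.Sentence := ∀' ∀' ((&0 ∗ₜ (&0 ∗ₜ &1)) =' &1)

theorem realize_leftDistributiveSentence (S : algebraLang.Structure ℕ) :
    @Sentence.Realize _ ℕ S leftDistributiveSentence ↔ LeftDistributive (starOp S) := by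
  simp [leftDistributiveSentence, Sentence.Realize, Formula.Realize, LeftDistributive, starOp,
    Fin.snoc]

theorem realize_uniquelySolvableSentence (S : algebraLang.Structure ℕ) :
    @Sentence.Realize _ ℕ S uniquelySolvableSentence ↔ UniquelySolvable (starOp S) := by
  simp [uniquelySolvableSentence, Sentence.Realize, Formula.Realize, UniquelySolvable, starOp,
    Fin.snoc, ExistsUnique]

theorem realize_idempotentSentence (S : algebraLang.Structure ℕ) :
    @Sentence.Realize _ ℕ S idempotentSentence ↔ Idempotent (starOp S) := by
  simp [idempotentSentence, Sentence.Realize, Formula.Realize, Idempotent, starOp,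
    Fin.snoc]

theorem realize_involutorySentence (S : algebraLang.Structure ℕ) :
    @Sentence.Realize _ ℕ S involutorySentence ↔ Involutory (starOp S) := by
  simp [involutorySentence, Sentence.Realize, Formula.Realize, Involutory, starOp,
    Fin.snoc]
end

section
open FirstOrder FirstOrder.Language
local infixl:80 " ∗ₜ " => Functions.apply₂ (L := sigmaLang) SigmaOp.star
local infixl:80 " ∘ₜ " => Functions.apply₂ (L := sigmaLang) SigmaOp.circ

/-- The identities `Σ` as a theory. -/
def sigmaTheory : sigmaLang.Theory :=
  {∀' ∀' ∀' ((&0 ∘ₜ (&1 ∘ₜ &2)) =' ((&0 ∘ₜ &1) ∘ₜ &2)),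
   ∀' ∀' ∀' (((&0 ∘ₜ &1) ∗ₜ &2) =' (&0 ∗ₜ (&1 ∗ₜ &2))),
   ∀' ∀' ∀' ((&0 ∗ₜ (&1 ∘ₜ &2)) =' ((&0 ∗ₜ &1) ∘ₜ (&0 ∗ₜ &2))),
   ∀' ∀' (((&0 ∗ₜ &1) ∘ₜ &0) =' (&0 ∘ₜ &1))}

theorem model_sigmaTheory (S : sigmaLang.Structure ℕ) :
    @Theory.Model _ ℕ S sigmaTheory ↔ SatisfiesSigma (sigmaStar S) (sigmaCirc S) := by
  have : SatisfiesSigma (sigmaStar S) (sigmaCirc S) ↔ _ ∧ _ ∧ _ ∧ _ :=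
    ⟨fun h => ⟨h.1, h.2, h.3, h.4⟩, fun h => ⟨h.1, h.2.1, h.2.2.1, h.2.2.2⟩⟩
  rw [this]
  simp [sigmaTheory, Theory.model_iff, Sentence.Realize, Formula.Realize, sigmaStar, sigmaCirc,
    Fin.snoc]
end

instance : Finite algebraLang.Symbols :=
  .of_surjective (fun _ : Unit => .inl ⟨2, .star⟩)
    (by rintro (⟨_, ⟨⟩⟩ | ⟨_, ⟨⟩⟩); exact ⟨(), rfl⟩)

instance : Finite sigmaLang.Symbols :=
  .of_surjective (fun b : Bool => .inl ⟨2, if b then .star else .circ⟩)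
    (by rintro (⟨_, (⟨⟩ | ⟨⟩)⟩ | ⟨_, ⟨⟩⟩); exacts [⟨true, rfl⟩, ⟨false, rfl⟩])

theorem isFirstOrderClass_leftDistributiveAlgebras :
    IsFirstOrderClass leftDistributiveAlgebras := by
  refine ⟨inferInstance, {leftDistributiveSentence}, ?_⟩
  simp [leftDistributiveAlgebras, FirstOrder.Language.Theory.model_iff,
    realize_leftDistributiveSentence]

theorem isFirstOrderClass_racks : IsFirstOrderClass racks := by
  refine ⟨inferInstance, {leftDistributiveSentence, uniquelySolvableSentence}, ?_⟩
  simp [racks, FirstOrder.Language.Theory.model_iff,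
    realize_leftDistributiveSentence, realize_uniquelySolvableSentence]

theorem isFirstOrderClass_quandles : IsFirstOrderClass quandles := by
  refine ⟨inferInstance,
    {leftDistributiveSentence, uniquelySolvableSentence, idempotentSentence}, ?_⟩
  simp [quandles, FirstOrder.Language.Theory.model_iff,
    realize_leftDistributiveSentence, realize_uniquelySolvableSentence,
    realize_idempotentSentence]

theorem isFirstOrderClass_keis : IsFirstOrderClass keis := by
  refine ⟨inferInstance, {leftDistributiveSentence, uniquelySolvableSentence,
    idempotentSentence, involutorySentence}, ?_⟩
  simp [keis, FirstOrder.Language.Theory.model_iff,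
    realize_leftDistributiveSentence, realize_uniquelySolvableSentence,
    realize_idempotentSentence, realize_involutorySentence]

theorem isFirstOrderClass_sigmaAlgebras : IsFirstOrderClass sigmaAlgebras := by
  refine ⟨inferInstance, sigmaTheory, ?_⟩
  simp [sigmaAlgebras, model_sigmaTheory]

/-! ### Borel completeness -/

/-- A first-order class is Borel complete as soon as digraphs on `Node` can be coded in it up to
isomorphism by a map `f` that is continuous, in the sense that it preserves continuous dependence on
a parameter. -/
theorem isBorelComplete_of_continuous {L : FirstOrder.Language.{0, 0}} {K : Set (L.Structure ℕ)}
    (hK : IsFirstOrderClass K)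
    (f : (Node → Node → Prop) → L.Structure ℕ) (hfK : ∀ R, f R ∈ K)
    (hf : ∀ R R', Nonempty (R ≃r R') ↔
      Nonempty (@FirstOrder.Language.Equiv L ℕ ℕ (f R) (f R')))
    (hcont : ∀ (Ω : Type) [TopologicalSpace Ω] (R : Ω → Node → Node → Prop),
      (∀ x y, IsClopen {ω | R ω x y}) → Continuous fun ω => f (R ω)) :
    IsBorelComplete K := by
  refine ⟨hK, fun L' K' hK' => ?_⟩
  have := hK'.1
  obtain ⟨e, he⟩ := exists_injective_nat L'.Symbols
  refine ⟨fun S => ⟨f (Arrow (Fact e S.1)), hfK _⟩, ?_, fun S S' => ?_⟩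
  · have h : Continuous fun S : L'.Structure ℕ => f (Arrow (Fact e S)) :=
      hcont _ _ (isClopen_arrow (isClopen_fact he))
    exact ((h.comp continuous_subtype_val).subtype_mk _).borel_measurable
  · exact (nonempty_equiv_iff_factIso he S.1 S'.1).trans (factIso_iff_relIso.trans (hf _ _))

instance : Infinite Node := .of_injective Node.elem fun _ _ => Node.elem.inj

instance {X : Type} [Infinite X] : Infinite (Point X) :=
  .of_injective Point.src fun _ _ => Point.src.inj

instance {X : Type} [Infinite X] : Infinite (SemigroupCarrier X) :=
  .of_injective SemigroupCarrier.pt fun _ _ => SemigroupCarrier.pt.inj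

theorem isBorelComplete_of_keis_subset {K : Set (algebraLang.Structure ℕ)}
    (hK : IsFirstOrderClass K) (hsub : keis ⊆ K) : IsBorelComplete K := by
  obtain ⟨e⟩ := nonempty_equiv_of_countable (α := KeiCarrier Node) (β := ℕ)
  refine isBorelComplete_of_continuous hK (fun R => algebraOf (transportOp e (keiOp R)))
    (fun R => hsub ?_) (fun R R' => ?_) (fun Ω _ R hR => ?_)
  · have hinv : Involutory (transportOp e (keiOp R)) := involutory_keiOp.transportOp
    exact ⟨leftDistributive_keiOp.transportOp, hinv.uniquelySolvable,
      idempotent_keiOp.transportOp, hinv⟩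
  · rw [nonempty_equiv_algebraOf, exists_opIso_transportOp_iff, nonempty_relIso_iff_keiOp]
  · exact continuous_algebraOf (isClopen_transportOp (isClopen_keiOp hR))

theorem isBorelComplete_sigmaAlgebras : IsBorelComplete sigmaAlgebras := by
  obtain ⟨e⟩ := nonempty_equiv_of_countable (α := SemigroupCarrier Node) (β := ℕ)
  refine isBorelComplete_of_continuous isFirstOrderClass_sigmaAlgebras
    (fun R => sigmaOf (fun _ b => b) (transportOp e (semigroupOp R)))
    (fun R => ?_) (fun R R' => ?_) (fun Ω _ R hR => ?_)
  · have hassoc (a b c : ℕ) : transportOp e (semigroupOp R) a (transportOp e (semigroupOp R) b c) =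
        transportOp e (semigroupOp R) (transportOp e (semigroupOp R) a b) c := by
      simp only [transportOp, Equiv.symm_apply_apply]
      rw [semigroupOp_assoc]
    exact satisfiesSigma_of_comm_assoc (fun _ _ => congrArg e (semigroupOp_comm _ _)) hassoc
  · rw [nonempty_equiv_sigmaOf, exists_opIso_transportOp_iff, nonempty_relIso_iff_semigroupOp]
  · exact continuous_sigmaOf (isClopen_transportOp (isClopen_semigroupOp hR))

end CountableModels

theorem theorem3p6 :
    CountableModels.IsBorelComplete CountableModels.keis ∧
    CountableModels.IsBorelComplete CountableModels.quandles ∧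
    CountableModels.IsBorelComplete CountableModels.racks ∧
    CountableModels.IsBorelComplete CountableModels.leftDistributiveAlgebras ∧
    CountableModels.IsBorelComplete CountableModels.sigmaAlgebras := by
  open CountableModels in
  exact ⟨isBorelComplete_of_keis_subset isFirstOrderClass_keis subset_rfl,
    isBorelComplete_of_keis_subset isFirstOrderClass_quandles fun _ h => ⟨h.1, h.2.1, h.2.2.1⟩,
    isBorelComplete_of_keis_subset isFirstOrderClass_racks fun _ h => ⟨h.1, h.2.1⟩,
    isBorelComplete_of_keis_subset isFirstOrderClass_leftDistributiveAlgebras fun _ h => h.1,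
    isBorelComplete_sigmaAlgebras⟩
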